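/- Let $n\ge 1$ and let $\mathbb R_n$ be the real Clifford algebra with imaginary units $e_1,\dots,e_n$ ($e_i^2=-1$, $e_ie_j=-e_je_i$ for $i\ne j$), $e_0=1$, normed by $|\sum_A a_Ae_A|^2=\sum_A a_A^2$. Identify $x=(x_0,\dots,x_n)\in\mathbb R^{n+1}$ with the paravector $x_0+x_1e_1+\dots+x_ne_n$. A function $f:\mathbb R^{n+1}\to\mathbb R_n$ is *entire left monogenic* if it is of class $C^1$ and $\partial_{x_0}f+\sum_{i=1}^n e_i\,\partial_{x_i}f=0$ on $\mathbb R^{n+1}$. For $\sigma>0$, let $A_{1,\sigma}$ be the space of entire left monogenic $f$ with $\|f\|_{1,\sigma}:=\sup_x|f(x)|e^{-\sigma|x|}<\infty$. A sequence $(f_N)$ *converges to $f$ in $A_1$* if there is $\sigma>0$ such that $f\in A_{1,\sigma}$, $f_N\in A_{1,\sigma}$ for all $N$, and $\|f_N-f\|_{1,\sigma}\to0$. With $z_i=x_i-x_0e_i$, let $$E(x)=\sum_{k=0}^\infty\frac1{k!}\sum_{\ell_1,\dots,\ell_k=1}^n\Big(\frac1{k!}\sum_{\pi\in S_k}z_{\ell_{\pi(1)}}\cdots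 z_{\ell_{\pi(k)}}\Big)e_{\ell_1}\cdots e_{\ell_k}$$ be the monogenic exponential function, that is, the Cauchy–Kowalewski (left monogenic) extension of $e^{x_1e_1+\dots+x_ne_n}$. **Theorem.** Let $a\in\mathbb R$ with $|a|>1$. For $N\in\mathbb N$ and $0\le j\le N$ let $h_j(N)\in\mathbb R$ and $Z_j(N,a)\in\mathbb R_n$ be such that $$f_N(x,a)=\sum_{j=0}^N E(h_j(N)x)\,Z_j(N,a)$$ converges to $E(ax)$ in $A_1$. Let $G$ be entire left monogenic, and let $g_0,\dots,g_n:\mathbb R\to\mathbb R$ be entire real analytic functions, i.e. $g_k(t)=\sum_{\ell=0}^\infty g_{k,\ell}\,t^\ell$ with real coefficients, the series converging for every $t\in\mathbb R$. Then $$F_N(x,a)=\sum_{j=0}^N Z_j(N,a)\,G\big(e_0x_0\,g_0(h_j(N))+e_1x_1\,g_1(h_j(N))+\dots+e_nx_n\,g_n(h_j(N))\big)$$ has the supershift property $$\lim_{N\to\infty}F_N(x,a)=G\big(e_0x_0\,g_0(a)+e_1x_1\,g_1(a)+\dots+e_nx_n\,g_n(a)\big)$$ uniformly on every compact subset of $\mathbb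 R^{n+1}$. -/

import Mathlib

open Filter Topology

noncomputable section

namespace Monogenic

/-- The negative definite quadratic form `v ↦ -(v₁² + ⋯ + vₙ²)` on `ℝⁿ`. -/
def negSq (n : ℕ) : QuadraticForm ℝ (Fin n → ℝ) :=
  QuadraticMap.weightedSumSquares ℝ (fun _ : Fin n => (-1 : ℝ))

/-- The real Clifford algebra `ℝₙ` with `n` imaginary units, `eᵢ² = -1`, `eᵢ eⱼ = -eⱼ eᵢ`. -/
abbrev Cl (n : ℕ) : Type := CliffordAlgebra (negSq n)

/-- The imaginary units; `e i` is the unit usually written with index `i + 1`. -/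
def e {n : ℕ} (i : Fin n) : Cl n := CliffordAlgebra.ι (negSq n) (Pi.single i 1)

/-- `e_A = e_{i₁} ⋯ e_{i_r}` for `A = {i₁ < ⋯ < i_r}`, with `e_∅ = 1`. -/
def blade {n : ℕ} (A : Finset (Fin n)) : Cl n :=
  (List.ofFn fun r : Fin A.card => e (A.orderEmbOfFin rfl r)).prod

/-- The linear map `(a_A)_A ↦ ∑_A a_A e_A`. -/
def ofCoord (n : ℕ) : EuclideanSpace ℝ (Finset (Fin n)) →ₗ[ℝ] Cl n where
  toFun a := ∑ A, a A • blade A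
  map_add' a b := by simp [add_smul, Finset.sum_add_distrib]
  map_smul' r a := by simp [mul_smul, Finset.smul_sum]

theorem contractLeft_prod_eq_zero {n : ℕ} (d : Module.Dual ℝ (Fin n → ℝ)) (l : List (Fin n))
    (h : ∀ i ∈ l, d (Pi.single i 1) = 0) :
    CliffordAlgebra.contractLeft d
      ((l.map fun i => CliffordAlgebra.ι (0 : QuadraticForm ℝ (Fin n → ℝ))
        (Pi.single i 1)).prod) = 0 := by
  induction l with
  | nil => simp
  | cons a l ih =>
    rw [List.map_cons, List.prod_cons, CliffordAlgebra.contractLeft_ι_mul,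
      h a (by simp), ih (fun i hi => h i (by simp [hi]))]
    simp

theorem equivExterior_prod {n : ℕ} (l : List (Fin n)) (hl : l.Nodup) :
    CliffordAlgebra.equivExterior (negSq n) ((l.map e).prod) =
      (l.map fun i => CliffordAlgebra.ι (0 : QuadraticForm ℝ (Fin n → ℝ))
        (Pi.single i 1)).prod := by
  induction l with
  | nil => simp
  | cons a l ih =>
    rw [List.nodup_cons] at hl
    have ih' := ih hl.2
    rw [CliffordAlgebra.equivExterior, CliffordAlgebra.changeFormEquiv_apply] at ih' ⊢
    rw [List.map_cons, List.prod_cons, List.map_cons, List.prod_cons, e,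
      CliffordAlgebra.changeForm_ι_mul, ih', contractLeft_prod_eq_zero, sub_zero]
    intro i hi
    have hai : a ≠ i := fun h => hl.1 (h ▸ hi)
    have h1 : ∀ j : Fin n, (Pi.single a 1 : Fin n → ℝ) j * (Pi.single i 1 : Fin n → ℝ) j = 0 := by
      intro j
      by_cases hj : j = a
      · subst hj; simp [hai]
      · simp [hj]
    have h2 : QuadraticMap.polar (negSq n) (Pi.single a 1) (Pi.single i 1) = 0 := by
      simp only [QuadraticMap.polar, negSq, QuadraticMap.weightedSumSquares_apply,
        ← Finset.sum_sub_distrib]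
      refine Finset.sum_eq_zero fun j _ => ?_
      simp only [Pi.add_apply, smul_eq_mul]
      linear_combination (-2) * h1 j
    simp [QuadraticMap.associated_apply, QuadraticMap.polar] at h2 ⊢
    linarith

theorem equivExterior_blade {n : ℕ} (A : Finset (Fin n)) :
    CliffordAlgebra.equivExterior (negSq n) (blade A) =
      (Pi.basisFun ℝ (Fin n)).ExteriorAlgebra A := by
  have h := equivExterior_prod (List.ofFn fun r : Fin A.card => A.orderEmbOfFin rfl r)
    (List.nodup_ofFn.2 (A.orderEmbOfFin rfl).injective)
  rw [List.map_ofFn, List.map_ofFn] at h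
  refine Eq.trans h ?_
  rw [ExteriorAlgebra.basis_apply_ofCard _ (rfl : A.card = A.card)]
  simp only [ExteriorAlgebra.ιMulti_family, ExteriorAlgebra.ιMulti_apply]
  congr 2
  funext r
  simp only [Function.comp_apply, Pi.basisFun_apply]
  rfl

/-- The products `e_A` form a basis of the Clifford algebra. -/
theorem ofCoord_bijective (n : ℕ) : Function.Bijective (ofCoord n) := by
  have key : ∀ a : EuclideanSpace ℝ (Finset (Fin n)),
      CliffordAlgebra.equivExterior (negSq n) (ofCoord n a) =
        (Pi.basisFun ℝ (Fin n)).ExteriorAlgebra.equivFun.symm a := by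
    intro a
    simp only [ofCoord, LinearMap.coe_mk, AddHom.coe_mk, map_sum, map_smul, equivExterior_blade,
      Module.Basis.equivFun_symm_apply]
  constructor
  · intro a b hab
    have h := congrArg (CliffordAlgebra.equivExterior (negSq n)) hab
    rw [key, key] at h
    exact WithLp.ofLp_injective 2 ((LinearEquiv.injective _) h)
  · intro y
    refine ⟨WithLp.toLp 2 ((Pi.basisFun ℝ (Fin n)).ExteriorAlgebra.equivFun
      (CliffordAlgebra.equivExterior (negSq n) y)), ?_⟩
    apply (CliffordAlgebra.equivExterior (negSq n)).injective
    rw [key]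
    exact LinearEquiv.symm_apply_apply _ _

/-- The coordinates `(a_A)_A` of `a = ∑_A a_A e_A`. -/
def coord (n : ℕ) : Cl n ≃ₗ[ℝ] EuclideanSpace ℝ (Finset (Fin n)) :=
  (LinearEquiv.ofBijective (ofCoord n) (ofCoord_bijective n)).symm

/-- The Euclidean norm `|a|² = ∑_A |a_A|²` on the Clifford algebra. -/
instance instNormedAddCommGroupCl (n : ℕ) : NormedAddCommGroup (Cl n) :=
  NormedAddCommGroup.induced (Cl n) (EuclideanSpace ℝ (Finset (Fin n))) (coord n)
    (coord n).injective

instance instNormedSpaceCl (n : ℕ) : NormedSpace ℝ (Cl n) :=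
  NormedSpace.induced ℝ (Cl n) (EuclideanSpace ℝ (Finset (Fin n))) (coord n)

/-- The space `ℝⁿ⁺¹` of paravectors: the point `x` stands for `x₀ + x₁ e₁ + ⋯ + xₙ eₙ`. -/
abbrev Para (n : ℕ) : Type := EuclideanSpace ℝ (Fin (n + 1))

/-- The partial derivative `∂f/∂x_k`. -/
def pderiv {n : ℕ} (k : Fin (n + 1)) (f : Para n → Cl n) (x : Para n) : Cl n :=
  fderiv ℝ f x (EuclideanSpace.single k 1)

/-- Entire left monogenic functions: `f` is `C¹` on `ℝⁿ⁺¹` and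
`∂f/∂x₀ + ∑ᵢ eᵢ ∂f/∂xᵢ = 0`. -/
def IsEntireLeftMonogenic {n : ℕ} (f : Para n → Cl n) : Prop :=
  ContDiff ℝ 1 f ∧ ∀ x, pderiv 0 f x + ∑ i : Fin n, e i * pderiv i.succ f x = 0

/-- `‖f‖_{1,σ} = sup_x |f(x)| e^{-σ|x|}` (meaningful when the supremum is finite). -/
def normA1 {n : ℕ} (σ : ℝ) (f : Para n → Cl n) : ℝ :=
  ⨆ x : Para n, ‖f x‖ * Real.exp (-σ * ‖x‖)

/-- Membership in `A_{1,σ}`: entire left monogenic with `‖f‖_{1,σ} < ∞`. -/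
def MemA1 {n : ℕ} (σ : ℝ) (f : Para n → Cl n) : Prop :=
  IsEntireLeftMonogenic f ∧
    BddAbove (Set.range fun x : Para n => ‖f x‖ * Real.exp (-σ * ‖x‖))

/-- Convergence of a sequence in `A₁`: for some `σ > 0` all terms and the limit belong to
`A_{1,σ}`, and the sequence converges in the norm of `A_{1,σ}`. -/
def ConvergesInA1 {n : ℕ} (F : ℕ → Para n → Cl n) (f : Para n → Cl n) : Prop :=
  ∃ σ : ℝ, 0 < σ ∧ MemA1 σ f ∧ (∀ N, MemA1 σ (F N)) ∧
    Tendsto (fun N => normA1 σ (fun x => F N x - f x)) atTop (𝓝 0)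

/-- The Fueter variable `zᵢ = xᵢ - x₀ eᵢ`. -/
def fueterVar {n : ℕ} (i : Fin n) (x : Para n) : Cl n :=
  algebraMap ℝ (Cl n) (x i.succ) - x 0 • e i

/-- The Fueter polynomial `(1/k!) ∑_σ z_{ℓ_{σ(1)}} ⋯ z_{ℓ_{σ(k)}}` of the sequence of indices
`ℓ₁, …, ℓ_k`; it depends only on how often each index occurs in the sequence, and it is the
Cauchy–Kowalewski product `z_{ℓ₁} ⊙ ⋯ ⊙ z_{ℓ_k}`. -/
def fueterPoly {n k : ℕ} (ℓ : Fin k → Fin n) (x : Para n) : Cl n :=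
  ((k.factorial : ℝ)⁻¹) •
    ∑ s : Equiv.Perm (Fin k), (List.ofFn fun r : Fin k => fueterVar (ℓ (s r)) x).prod

/-- The term `(z₁e₁ + ⋯ + zₙeₙ)^{⊙ k} = ∑_{ℓ₁,…,ℓ_k} (z_{ℓ₁} ⊙ ⋯ ⊙ z_{ℓ_k}) e_{ℓ₁} ⋯ e_{ℓ_k}`. -/
def ckPow {n : ℕ} (k : ℕ) (x : Para n) : Cl n :=
  ∑ ℓ : Fin k → Fin n, fueterPoly ℓ x * (List.ofFn fun r : Fin k => e (ℓ r)).prod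

/-- The monogenic exponential `E(x) = ∑_k (1/k!) (z₁e₁ + ⋯ + zₙeₙ)^{⊙ k}`, the
Cauchy–Kowalewski extension of `exp(x₁e₁ + ⋯ + xₙeₙ)`. -/
def monExp {n : ℕ} (x : Para n) : Cl n :=
  ∑' k : ℕ, ((k.factorial : ℝ)⁻¹) • ckPow k x

/-- A real analytic function on `ℝ` given on the whole line by its Taylor series at `0`. -/
def IsEntireReal (g : ℝ → ℝ) : Prop :=
  ∃ c : ℕ → ℝ, ∀ t : ℝ, HasSum (fun l : ℕ => c l * t ^ l) (g t)

end Monogenic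

end

/-!
Write `Λ_N φ = ∑_j Z_j φ(h_j) - φ(a)` for functions `φ` of a real variable. The claim is that
`Λ_N` tends to zero on `t ↦ G(x₀ g₀(t), …, xₙ gₙ(t))`, locally uniformly in `x`.

Everything rests on Cauchy estimates for monogenic functions. A `C¹` monogenic function is weakly
harmonic, because `∫ (D̄ψ)(Df) = 0` and integration by parts removes the mixed derivatives
(`IsEntireLeftMonogenic.integral_grad_smul_pderiv`). Testing with a radial `ψ` gives the mean value
property with a smooth weight (`IsEntireLeftMonogenic.integral_bumpKer_smul`), hence smoothness, the
interior gradient estimate `IsEntireLeftMonogenic.norm_pderiv_le`, and by iteration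
`‖(∑ yᵢ ∂ᵢ)ᵏ f(x)‖ ≤ (C k ‖y‖ / r)ᵏ sup_{B(x, r)} ‖f‖`. As `r` may be taken arbitrarily large, the
Taylor series of an entire monogenic function converges everywhere
(`IsEntireLeftMonogenic.hasSum_homTaylor`).

*Moments.* On the `x₁`-axis the monogenic exponential is `cos t + e₁ sin t`, so the Taylor
coefficients of `D_N = f_N - E(a ·)` along this axis are `e₁ˡ (∑_j h_jˡ Z_j - aˡ) / l!`. From
`‖D_N(x)‖ ≤ ε_N e^{σ‖x‖}` and the Cauchy estimate with `r = l` it follows that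
`‖Λ_N(tˡ)‖ ≤ ε_N Bˡ` with `B` independent of `N` and `l` (`norm_errL_pow_le`).

*Conclusion.* Consequently `Λ_N` is bounded by a multiple of `ε_N` times the norm `∑ |c_l| Bˡ` of a
power series `∑ c_l tˡ`. This norm is submultiplicative and finite for every `g_i`. Applying `Λ_N`
to the Taylor series of `G` at `(x_i g_i(t))_i` term by term, and the Cauchy estimates to the Taylor
coefficients of `G`, bounds the sum by a convergent geometric series times `ε_N`
(`exists_norm_errL_comp_le`).
-/

noncomputable section

namespace Monogenic

open MeasureTheory

/-! ### The Clifford algebra as a normed space -/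

theorem e_mul_self {n : ℕ} (i : Fin n) : e i * e i = (-1 : Cl n) := by
  rw [e, CliffordAlgebra.ι_sq_scalar]
  have h : negSq n (Pi.single i 1) = -1 := by
    simp [negSq, QuadraticMap.weightedSumSquares_apply, Pi.single_apply]
  rw [h, map_neg, map_one]

theorem e_mul_e_add_swap {n : ℕ} {i j : Fin n} (hij : i ≠ j) : e i * e j + e j * e i = 0 := by
  rw [e, e, CliffordAlgebra.ι_mul_ι_add_swap]
  have h : QuadraticMap.polar (negSq n) (Pi.single i 1) (Pi.single j 1) = 0 := by
    simp only [QuadraticMap.polar, negSq, QuadraticMap.weightedSumSquares_apply,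
      ← Finset.sum_sub_distrib]
    refine Finset.sum_eq_zero fun k _ => ?_
    have h1 : (Pi.single i 1 : Fin n → ℝ) k * (Pi.single j 1 : Fin n → ℝ) k = 0 := by
      by_cases hk : k = i
      · subst hk; simp [hij]
      · simp [hk]
    simp only [Pi.add_apply, smul_eq_mul]
    linear_combination (-2) * h1
  rw [h, map_zero]

instance instFiniteDimensionalCl (n : ℕ) : FiniteDimensional ℝ (Cl n) :=
  (coord n).symm.finiteDimensional

instance instCompleteSpaceCl (n : ℕ) : CompleteSpace (Cl n) := FiniteDimensional.complete ℝ _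

/-- Multiplication of the Clifford algebra as a continuous bilinear map. -/
def mulL (n : ℕ) : Cl n →L[ℝ] Cl n →L[ℝ] Cl n := (LinearMap.mul ℝ (Cl n)).toContinuousBilinearMap

@[simp] theorem mulL_apply {n : ℕ} (a b : Cl n) : mulL n a b = a * b := rfl

theorem norm_mul_le_mulL {n : ℕ} (a b : Cl n) : ‖a * b‖ ≤ ‖mulL n‖ * ‖a‖ * ‖b‖ :=
  (mulL n).le_opNorm₂ a b

/-- The units `1, e₁, …, eₙ` attached to the coordinates of a paravector. -/
def paraUnit {n : ℕ} : Fin (n + 1) → Cl n := Fin.cons 1 e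

/-- The conjugates `1, -e₁, …, -eₙ` of the paravector units. -/
def paraConj {n : ℕ} : Fin (n + 1) → Cl n := Fin.cons 1 fun i => -e i

theorem paraConj_mul_paraUnit_add_swap {n : ℕ} (j k : Fin (n + 1)) :
    (paraConj j * paraUnit k + paraConj k * paraUnit j : Cl n) = if j = k then 2 else 0 := by
  have h2 : (1 + 1 : Cl n) = 2 := one_add_one_eq_two
  refine Fin.cases ?_ (fun j => ?_) j <;> refine Fin.cases ?_ (fun k => ?_) k
  · simp [paraConj, paraUnit, h2]
  · simp [paraConj, paraUnit, (Fin.succ_ne_zero k).symm]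
  · simp [paraConj, paraUnit]
  · by_cases hjk : j = k
    · subst hjk
      simp [paraConj, paraUnit, e_mul_self, h2]
    · simp only [paraConj, paraUnit, Fin.cons_succ, Fin.succ_inj, hjk, if_false, neg_mul]
      rw [← neg_add, e_mul_e_add_swap hjk, neg_zero]

theorem IsEntireLeftMonogenic.sum_paraUnit_mul {n : ℕ} {f : Para n → Cl n}
    (hf : IsEntireLeftMonogenic f) (x : Para n) : ∑ k, paraUnit k * pderiv k f x = 0 := by
  rw [Fin.sum_univ_succ]
  simpa [paraUnit] using hf.2 x

theorem isEntireLeftMonogenic_iff {n : ℕ} {f : Para n → Cl n} :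
    IsEntireLeftMonogenic f ↔ ContDiff ℝ 1 f ∧ ∀ x, ∑ k, paraUnit k * pderiv k f x = 0 := by
  simp [IsEntireLeftMonogenic, Fin.sum_univ_succ, paraUnit]

theorem pderiv_comp_add_smul {n : ℕ} {f : Para n → Cl n} (hf : Differentiable ℝ f) (a : Para n)
    (r : ℝ) (k : Fin (n + 1)) (x : Para n) :
    pderiv k (fun y => f (a + r • y)) x = r • pderiv k f (a + r • x) := by
  have h1 : HasFDerivAt (fun y : Para n => a + r • y) (r • ContinuousLinearMap.id ℝ (Para n)) x :=
    ((hasFDerivAt_id x).const_smul r).const_add a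
  have h2 := (hf (a + r • x)).hasFDerivAt.comp x h1
  rw [pderiv, show (fun y => f (a + r • y)) = f ∘ fun y => a + r • y from rfl, h2.fderiv]
  simp [pderiv]

theorem IsEntireLeftMonogenic.comp_add_smul {n : ℕ} {f : Para n → Cl n}
    (hf : IsEntireLeftMonogenic f) (a : Para n) (r : ℝ) :
    IsEntireLeftMonogenic fun y => f (a + r • y) := by
  refine isEntireLeftMonogenic_iff.2
    ⟨hf.1.comp (contDiff_const.add (contDiff_id.const_smul r)), fun x => ?_⟩
  simp only [pderiv_comp_add_smul (hf.1.differentiable one_ne_zero), mul_smul_comm,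
    ← Finset.smul_sum, hf.sum_paraUnit_mul, smul_zero]

theorem IsEntireLeftMonogenic.sub {n : ℕ} {f f' : Para n → Cl n}
    (hf : IsEntireLeftMonogenic f) (hf' : IsEntireLeftMonogenic f') :
    IsEntireLeftMonogenic fun y => f y - f' y := by
  refine isEntireLeftMonogenic_iff.2 ⟨hf.1.sub hf'.1, fun x => ?_⟩
  have h (k : Fin (n + 1)) : pderiv k (fun y => f y - f' y) x = pderiv k f x - pderiv k f' x := by
    rw [pderiv, fderiv_fun_sub (hf.1.differentiable one_ne_zero x)
      (hf'.1.differentiable one_ne_zero x)]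
    rfl
  simp only [h, mul_sub, Finset.sum_sub_distrib, hf.sum_paraUnit_mul, hf'.sum_paraUnit_mul,
    sub_zero]

theorem continuous_pderiv {n : ℕ} {f : Para n → Cl n} (hf : ContDiff ℝ 1 f) (k : Fin (n + 1)) :
    Continuous (pderiv k f) :=
  (hf.continuous_fderiv one_ne_zero).clm_apply continuous_const

theorem fderiv_apply_eq_sum_pderiv {n : ℕ} (f : Para n → Cl n) (x y : Para n) :
    fderiv ℝ f x y = ∑ k, y k • pderiv k f x := by
  have hy : y = ∑ k, y k • EuclideanSpace.single k (1 : ℝ) := by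
    ext i
    simp [Finset.sum_apply, Pi.single_apply]
  conv_lhs => rw [hy]
  simp [map_sum, pderiv]

/-! ### Monogenic functions are weakly harmonic -/

theorem integral_fderiv_smul_eq_neg {n : ℕ} {φ : Para n → ℝ} (hφ : ContDiff ℝ 1 φ)
    (hφc : HasCompactSupport φ) {f : Para n → Cl n} (hf : ContDiff ℝ 1 f) (k : Fin (n + 1)) :
    ∫ y, φ y • pderiv k f y =
      -∫ y, fderiv ℝ φ y (EuclideanSpace.single k 1) • f y := by
  have hφ' : Continuous fun y => fderiv ℝ φ y (EuclideanSpace.single k 1) :=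
    (hφ.continuous_fderiv one_ne_zero).clm_apply continuous_const
  have hφc' : HasCompactSupport fun y => fderiv ℝ φ y (EuclideanSpace.single k 1) :=
    hφc.fderiv_apply ℝ _
  refine integral_smul_fderiv_eq_neg_fderiv_smul_of_integrable ?_ ?_ ?_
    (fun x _ => hφ.differentiable one_ne_zero x) (fun x _ => hf.differentiable one_ne_zero x)
  · exact (hφ'.smul hf.continuous).integrable_of_hasCompactSupport hφc'.smul_right
  · exact (hφ.continuous.smul (continuous_pderiv hf k)).integrable_of_hasCompactSupport
      hφc.smul_right
  · exact (hφ.continuous.smul hf.continuous).integrable_of_hasCompactSupport hφc.smul_right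

/-- A `C¹` function annihilated by the Dirac operator `D` is weakly harmonic: this is
`∫ (D̄ψ)(Df) = 0`, in which the mixed terms cancel because `∫ ∂_jψ ∂_kf` is symmetric in `j, k`
while `ē_j e_k` is antisymmetric off the diagonal. -/
theorem IsEntireLeftMonogenic.integral_grad_smul_pderiv {n : ℕ} {f : Para n → Cl n}
    (hf : IsEntireLeftMonogenic f) {ψ : Para n → ℝ} (hψ : ContDiff ℝ 2 ψ)
    (hψc : HasCompactSupport ψ) :
    ∑ k, ∫ y, fderiv ℝ ψ y (EuclideanSpace.single k 1) • pderiv k f y = 0 := by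
  set v : Fin (n + 1) → Para n := fun k => EuclideanSpace.single k 1 with hv
  set I : Fin (n + 1) → Fin (n + 1) → Cl n := fun j k =>
    ∫ y, fderiv ℝ ψ y (v j) • pderiv k f y with hI
  have hψ1 (j) : ContDiff ℝ 1 fun y => fderiv ℝ ψ y (v j) :=
    (hψ.fderiv_right (m := 1) (by norm_num)).clm_apply contDiff_const
  have hψc1 (j) : HasCompactSupport fun y => fderiv ℝ ψ y (v j) := hψc.fderiv_apply ℝ _
  have hint (j k) : Integrable fun y => fderiv ℝ ψ y (v j) • pderiv k f y :=
    ((hψ1 j).continuous.smul (continuous_pderiv hf.1 k)).integrable_of_hasCompactSupport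
      (hψc1 j).smul_right
  have hsymm (j k) : I j k = I k j := by
    simp only [hI]
    rw [integral_fderiv_smul_eq_neg (hψ1 j) (hψc1 j) hf.1,
      integral_fderiv_smul_eq_neg (hψ1 k) (hψc1 k) hf.1]
    congr 2
    funext y
    have hd : DifferentiableAt ℝ (fderiv ℝ ψ) y :=
      (hψ.fderiv_right (m := 1) (by norm_num)).differentiable one_ne_zero y
    have hs := (hψ.contDiffAt (x := y)).isSymmSndFDerivAt (by simp)
    have h1 (w w' : Para n) : fderiv ℝ (fun y => fderiv ℝ ψ y w) y w' =
        fderiv ℝ (fderiv ℝ ψ) y w' w := by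
      rw [fderiv_clm_apply hd (differentiableAt_const w)]
      simp
    rw [h1, h1, hs.eq]
  have hzero (j) : ∑ k, paraUnit k * I j k = 0 := by
    have h1 (k) : paraUnit k * I j k =
        ∫ y, fderiv ℝ ψ y (v j) • (paraUnit k * pderiv k f y) := by
      have := ((mulL n (paraUnit k)).integral_comp_comm (hint j k)).symm
      simpa [hI] using this
    simp only [h1]
    rw [← integral_finsetSum]
    · simp only [← Finset.smul_sum, hf.sum_paraUnit_mul, smul_zero, integral_zero]
    · intro k _
      simpa using (mulL n (paraUnit k)).integrable_comp (hint j k)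
  -- `hS` is `∫ (D̄ψ)(Df) = 0`; `hS'` is the same sum with `j, k` exchanged in the units only.
  have hS : ∑ j, ∑ k, paraConj j * paraUnit k * I j k = 0 := by
    simp only [mul_assoc, ← Finset.mul_sum, hzero, mul_zero, Finset.sum_const_zero]
  have hS' : ∑ j, ∑ k, paraConj k * paraUnit j * I j k = 0 := by
    rw [Finset.sum_comm, ← hS]
    exact Finset.sum_congr rfl fun j _ => Finset.sum_congr rfl fun k _ => by rw [hsymm]
  have h2 : (2 : ℝ) • ∑ j, I j j = 0 := by
    have := congrArg₂ (· + ·) hS hS'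
    simp only [← Finset.sum_add_distrib, ← add_mul, paraConj_mul_paraUnit_add_swap, ite_mul,
      zero_mul, Finset.sum_ite_eq, Finset.mem_univ, if_true, add_zero] at this
    rw [← this, Finset.smul_sum]
    exact Finset.sum_congr rfl fun j _ => by rw [two_smul, two_mul]
  exact (smul_eq_zero.1 h2).resolve_left two_ne_zero

/-! ### The mean value property and its consequences -/

/-- A smooth radial function supported in the unit ball. -/
def bumpPot {n : ℕ} (y : Para n) : ℝ := Real.smoothTransition (1 - ‖y‖ ^ 2)

/-- The radial weight with `∇ bumpPot = -2 bumpKer(y) y`. -/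
def bumpKer {n : ℕ} (y : Para n) : ℝ := deriv Real.smoothTransition (1 - ‖y‖ ^ 2)

theorem contDiff_one_sub_norm_sq {n : ℕ} {m : ℕ∞} :
    ContDiff ℝ m fun y : Para n => 1 - ‖y‖ ^ 2 :=
  contDiff_const.sub (contDiff_norm_sq ℝ)

theorem contDiff_bumpPot {n : ℕ} {m : ℕ∞} : ContDiff ℝ m (bumpPot (n := n)) :=
  Real.smoothTransition.contDiff.comp contDiff_one_sub_norm_sq

theorem contDiff_bumpKer {n : ℕ} {m : ℕ∞} : ContDiff ℝ m (bumpKer (n := n)) := by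
  have h : ContDiff ℝ m (deriv Real.smoothTransition) :=
    ((contDiff_infty_iff_deriv.1
      (Real.smoothTransition.contDiff (n := ⊤))).2).of_le (by exact_mod_cast le_top)
  exact h.comp contDiff_one_sub_norm_sq

theorem bumpPot_of_one_le {n : ℕ} {y : Para n} (hy : 1 ≤ ‖y‖) : bumpPot y = 0 :=
  Real.smoothTransition.zero_of_nonpos (by nlinarith)

theorem bumpKer_of_one_lt {n : ℕ} {y : Para n} (hy : 1 < ‖y‖) : bumpKer y = 0 := by
  have h : Real.smoothTransition =ᶠ[𝓝 (1 - ‖y‖ ^ 2)] fun _ => 0 := by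
    filter_upwards [eventually_lt_nhds (show 1 - ‖y‖ ^ 2 < 0 by nlinarith)] with s hs
    exact Real.smoothTransition.zero_of_nonpos hs.le
  rw [bumpKer, h.deriv_eq, deriv_const]

theorem hasCompactSupport_bumpPot {n : ℕ} : HasCompactSupport (bumpPot (n := n)) :=
  HasCompactSupport.intro (isCompact_closedBall 0 1) fun y hy =>
    bumpPot_of_one_le (by simpa using (not_le.1 (by simpa using hy)).le)

theorem hasCompactSupport_bumpKer {n : ℕ} : HasCompactSupport (bumpKer (n := n)) :=
  HasCompactSupport.intro (isCompact_closedBall 0 1) fun y hy =>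
    bumpKer_of_one_lt (not_le.1 (by simpa using hy))

theorem fderiv_bumpPot {n : ℕ} (y v : Para n) :
    fderiv ℝ bumpPot y v = -2 * bumpKer y * inner ℝ y v := by
  have h1 : HasFDerivAt (fun y : Para n => 1 - ‖y‖ ^ 2) (-(2 • innerSL ℝ y)) y :=
    (hasStrictFDerivAt_norm_sq y).hasFDerivAt.const_sub 1
  have h2 : HasDerivAt Real.smoothTransition (bumpKer y) (1 - ‖y‖ ^ 2) :=
    ((Real.smoothTransition.contDiff (n := 1)).differentiable one_ne_zero _).hasDerivAt
  have h3 := h2.comp_hasFDerivAt y h1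
  rw [show bumpPot = Real.smoothTransition ∘ fun y : Para n => 1 - ‖y‖ ^ 2 from rfl, h3.fderiv]
  simp
  ring

theorem bumpKer_nonneg {n : ℕ} (y : Para n) : 0 ≤ bumpKer y :=
  Real.smoothTransition.monotone.deriv_nonneg

theorem integral_bumpKer_pos {n : ℕ} : 0 < ∫ y : Para n, bumpKer y := by
  obtain ⟨s, hs, hs'⟩ := exists_deriv_eq_slope Real.smoothTransition zero_lt_one
    Real.smoothTransition.continuous.continuousOn
    ((Real.smoothTransition.contDiff (n := 1)).differentiable one_ne_zero).differentiableOn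
  refine (contDiff_bumpKer (m := 0)).continuous.integral_pos_of_hasCompactSupport_nonneg_nonzero
    hasCompactSupport_bumpKer bumpKer_nonneg
    (x := EuclideanSpace.single 0 (Real.sqrt (1 - s))) ?_
  rw [bumpKer, PiLp.norm_single, Real.norm_eq_abs, sq_abs,
    Real.sq_sqrt (by linarith [hs.2]), sub_sub_cancel, hs']
  simp

theorem continuous_bumpKer {n : ℕ} : Continuous (bumpKer (n := n)) :=
  (contDiff_bumpKer (m := 0)).continuous

/-- The derivative in `s` of the weighted mean `∫ ρ(y) f(a + s y) dy` vanishes: `ρ(y) y` is a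
multiple of the gradient of `bumpPot`, so this is weak harmonicity of `y ↦ f(a + s y)`. -/
theorem IsEntireLeftMonogenic.integral_bumpKer_smul_fderiv {n : ℕ} {f : Para n → Cl n}
    (hf : IsEntireLeftMonogenic f) (a : Para n) (s : ℝ) :
    ∫ y, bumpKer y • fderiv ℝ f (a + s • y) y = 0 := by
  set v : Fin (n + 1) → Para n := fun k => EuclideanSpace.single k 1 with hv
  have hψ (j) : Continuous fun y => fderiv ℝ (bumpPot (n := n)) y (v j) :=
    ((contDiff_bumpPot (m := 1)).continuous_fderiv one_ne_zero).clm_apply continuous_const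
  have hψc (j) : HasCompactSupport fun y => fderiv ℝ (bumpPot (n := n)) y (v j) :=
    hasCompactSupport_bumpPot.fderiv_apply ℝ _
  have hc : Continuous fun y : Para n => a + s • y := by fun_prop
  have hint (j) : Integrable fun y => fderiv ℝ bumpPot y (v j) • pderiv j f (a + s • y) :=
    ((hψ j).smul ((continuous_pderiv hf.1 j).comp hc)).integrable_of_hasCompactSupport
      (hψc j).smul_right
  have h1 (y : Para n) : bumpKer y • fderiv ℝ f (a + s • y) y =
      (-(1 / 2) : ℝ) • ∑ k, fderiv ℝ bumpPot y (v k) • pderiv k f (a + s • y) := by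
    rw [fderiv_apply_eq_sum_pderiv, Finset.smul_sum, Finset.smul_sum]
    refine Finset.sum_congr rfl fun k _ => ?_
    rw [fderiv_bumpPot, smul_smul, smul_smul]
    congr 1
    simp only [hv, EuclideanSpace.inner_single_right]
    simp
    ring
  simp only [h1]
  rw [integral_smul, integral_finsetSum _ fun j _ => hint j]
  -- For `s = 0` the function `y ↦ f (a + s y)` is constant, so its weak harmonicity says nothing
  -- about `∂_k f(a)`; there the integrals vanish because `∫ ∂_kψ = 0`.
  rcases eq_or_ne s 0 with rfl | hs
  · have h2 (k) : ∫ y, fderiv ℝ bumpPot y (v k) • pderiv k f (a + (0 : ℝ) • y) = 0 := by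
      have := integral_fderiv_smul_eq_neg (contDiff_bumpPot (m := 1)) hasCompactSupport_bumpPot
        (f := fun _ => pderiv k f a) contDiff_const k
      simpa [pderiv, hv] using this
    simp only [h2, Finset.sum_const_zero, smul_zero]
  · have h2 := (hf.comp_add_smul a s).integral_grad_smul_pderiv
      (contDiff_bumpPot (m := 2)) hasCompactSupport_bumpPot
    simp only [pderiv_comp_add_smul (hf.1.differentiable one_ne_zero), smul_comm _ s,
      integral_smul, ← Finset.smul_sum] at h2
    rw [(smul_eq_zero.1 h2).resolve_left hs, smul_zero]

/-- The mean value property, with a smooth radial weight. -/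
theorem IsEntireLeftMonogenic.integral_bumpKer_smul {n : ℕ} {f : Para n → Cl n}
    (hf : IsEntireLeftMonogenic f) (a : Para n) (r : ℝ) :
    ∫ y, bumpKer y • f (a + r • y) = (∫ y : Para n, bumpKer y) • f a := by
  have hfd := hf.1.continuous_fderiv one_ne_zero
  have key (s : ℝ) : HasDerivAt (fun s : ℝ => ∫ y, bumpKer y • f (a + s • y)) 0 s := by
    obtain ⟨M, hM⟩ := (isCompact_closedBall a (|s| + 1)).exists_bound_of_continuousOn
      hfd.continuousOn
    have hF (t : ℝ) : Continuous fun y : Para n => bumpKer y • f (a + t • y) :=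
      continuous_bumpKer.smul (hf.1.continuous.comp (by fun_prop))
    have h := hasDerivAt_integral_of_dominated_loc_of_deriv_le (μ := volume)
      (F := fun (s : ℝ) (y : Para n) => bumpKer y • f (a + s • y))
      (F' := fun s y => bumpKer y • fderiv ℝ f (a + s • y) y)
      (bound := fun y => bumpKer y * M) (x₀ := s)
      (Metric.ball_mem_nhds s one_pos)
      (Eventually.of_forall fun t => (hF t).aestronglyMeasurable)
      ((hF s).integrable_of_hasCompactSupport hasCompactSupport_bumpKer.smul_right)
      (continuous_bumpKer.smul ((hfd.comp (by fun_prop)).clm_apply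
        continuous_id)).aestronglyMeasurable
      (Eventually.of_forall fun y t ht => ?_)
      ((continuous_bumpKer.mul continuous_const).integrable_of_hasCompactSupport
        hasCompactSupport_bumpKer.mul_right)
      (Eventually.of_forall fun y t _ => ?_)
    · rw [hf.integral_bumpKer_smul_fderiv] at h
      exact h.2
    · rw [norm_smul, Real.norm_of_nonneg (bumpKer_nonneg y)]
      rcases le_or_gt ‖y‖ 1 with hy | hy
      · refine mul_le_mul_of_nonneg_left ?_ (bumpKer_nonneg y)
        have ht' : |t| ≤ |s| + 1 := by
          have h1 : |t - s| < 1 := by simpa [Real.dist_eq] using ht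
          linarith [abs_sub_abs_le_abs_sub t s]
        have hmem : a + t • y ∈ Metric.closedBall a (|s| + 1) := by
          rw [mem_closedBall_iff_norm, add_sub_cancel_left, norm_smul, Real.norm_eq_abs]
          nlinarith [abs_nonneg t, norm_nonneg y]
        calc ‖fderiv ℝ f (a + t • y) y‖ ≤ ‖fderiv ℝ f (a + t • y)‖ * ‖y‖ :=
              ContinuousLinearMap.le_opNorm _ _
          _ ≤ ‖fderiv ℝ f (a + t • y)‖ * 1 := by gcongr
          _ ≤ M := by rw [mul_one]; exact hM _ hmem
      · simp [bumpKer_of_one_lt hy]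
    · have h1 : HasDerivAt (fun t : ℝ => a + t • y) y t := by
        simpa using ((hasDerivAt_id t).smul_const y).const_add a
      have h2 : HasDerivAt (fun t : ℝ => f (a + t • y)) (fderiv ℝ f (a + t • y) y) t :=
        (hf.1.differentiable one_ne_zero _).hasFDerivAt.comp_hasDerivAt t h1
      exact h2.const_smul (bumpKer y)
  have h0 := is_const_of_deriv_eq_zero (fun s => (key s).differentiableAt)
    (fun s => (key s).deriv) r 0
  simp only [zero_smul, add_zero] at h0
  rw [h0, integral_smul_const]

/-- Elliptic regularity: by the mean value property `f` is a convolution with a smooth kernel. -/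
theorem IsEntireLeftMonogenic.contDiff {n : ℕ} {f : Para n → Cl n}
    (hf : IsEntireLeftMonogenic f) {m : ℕ∞} : ContDiff ℝ m f := by
  have h := hasCompactSupport_bumpKer.contDiff_convolution_left (μ := volume) (n := m)
    (ContinuousLinearMap.lsmul ℝ ℝ) (contDiff_bumpKer (n := n))
    (hf.1.continuous.locallyIntegrable)
  have h' : f = fun x => (∫ y : Para n, bumpKer y)⁻¹ •
      (convolution bumpKer f (ContinuousLinearMap.lsmul ℝ ℝ) volume) x := by
    funext x
    have hx : convolution bumpKer f (ContinuousLinearMap.lsmul ℝ ℝ) volume x =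
        (∫ y : Para n, bumpKer y) • f x := by
      rw [← hf.integral_bumpKer_smul x (-1)]
      simp [convolution, sub_eq_add_neg]
    rw [hx, inv_smul_smul₀ integral_bumpKer_pos.ne']
  rw [h']
  exact h.const_smul _

theorem IsEntireLeftMonogenic.pderiv {n : ℕ} {f : Para n → Cl n}
    (hf : IsEntireLeftMonogenic f) (k : Fin (n + 1)) : IsEntireLeftMonogenic (pderiv k f) := by
  have hf1 : ContDiff ℝ 1 (fderiv ℝ f) := (hf.contDiff (m := 2)).fderiv_right (by norm_num)
  refine isEntireLeftMonogenic_iff.2 ⟨hf1.clm_apply contDiff_const, fun x => ?_⟩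
  have hd := hf1.differentiable one_ne_zero x
  have hs := ((hf.contDiff (m := 2)).contDiffAt (x := x)).isSymmSndFDerivAt (by simp)
  have h1 (w w' : Para n) : fderiv ℝ (fun y => fderiv ℝ f y w) x w' =
      fderiv ℝ (fderiv ℝ f) x w' w := by
    rw [fderiv_clm_apply hd (differentiableAt_const w)]
    simp
  have h2 (j) : HasFDerivAt (fun x => paraUnit j * Monogenic.pderiv j f x)
      ((mulL n (paraUnit j)).comp
        (fderiv ℝ (Monogenic.pderiv j f) x)) x :=
    (mulL n (paraUnit j)).hasFDerivAt.comp x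
      ((hf1.clm_apply contDiff_const).differentiable one_ne_zero x).hasFDerivAt
  have h3 := HasFDerivAt.fun_sum fun j (_ : j ∈ Finset.univ) => h2 j
  have h4 : (fun x => ∑ j, paraUnit j * Monogenic.pderiv j f x) = fun _ => 0 :=
    funext hf.sum_paraUnit_mul
  rw [h4] at h3
  have h5 := congrArg (fun L => L (EuclideanSpace.single k 1))
    (h3.unique (hasFDerivAt_const (0 : Cl n) x))
  simp only [sum_apply, ContinuousLinearMap.comp_apply, mulL_apply,
    zero_apply] at h5
  rw [← h5]
  refine Finset.sum_congr rfl fun j _ => ?_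
  congr 1
  unfold Monogenic.pderiv
  rw [h1, h1, hs.eq]

/-- The constant of the interior gradient estimate for monogenic functions. -/
def gradConst (n : ℕ) : ℝ :=
  (∫ y : Para n, bumpKer y)⁻¹ *
    ∑ k, ∫ y : Para n, ‖fderiv ℝ bumpKer y (EuclideanSpace.single k 1)‖

theorem gradConst_nonneg (n : ℕ) : 0 ≤ gradConst n :=
  mul_nonneg (inv_nonneg.2 integral_bumpKer_pos.le)
    (Finset.sum_nonneg fun _ _ => integral_nonneg fun _ => norm_nonneg _)

theorem IsEntireLeftMonogenic.norm_pderiv_zero_le {n : ℕ} {f : Para n → Cl n}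
    (hf : IsEntireLeftMonogenic f) {M : ℝ}
    (hM : ∀ y ∈ Metric.closedBall (0 : Para n) 1, ‖f y‖ ≤ M) (k : Fin (n + 1)) :
    ‖Monogenic.pderiv k f 0‖ ≤ gradConst n * M := by
  have hM0 : 0 ≤ M := (norm_nonneg _).trans (hM 0 (by simp))
  set D : Fin (n + 1) → Para n → ℝ := fun k y => fderiv ℝ bumpKer y (EuclideanSpace.single k 1)
    with hD
  have hDc (k) : Continuous (D k) :=
    ((contDiff_bumpKer (m := 1)).continuous_fderiv one_ne_zero).clm_apply continuous_const
  have hDs (k) : HasCompactSupport (D k) := hasCompactSupport_bumpKer.fderiv_apply ℝ _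
  have hI := integral_bumpKer_pos (n := n)
  have h1 := (hf.pderiv k).integral_bumpKer_smul 0 1
  simp only [zero_add, one_smul] at h1
  rw [integral_fderiv_smul_eq_neg contDiff_bumpKer hasCompactSupport_bumpKer hf.1] at h1
  have h2 : ‖∫ y, D k y • f y‖ ≤ ∫ y, ‖D k y‖ * M := by
    refine norm_integral_le_of_norm_le ?_ (Eventually.of_forall fun y => ?_)
    · exact ((hDc k).norm.mul continuous_const).integrable_of_hasCompactSupport
        (hDs k).norm.mul_right
    · rw [norm_smul]
      by_cases hy : y ∈ Metric.closedBall (0 : Para n) 1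
      · exact mul_le_mul_of_nonneg_left (hM y hy) (norm_nonneg _)
      · have hz : D k y = 0 := by
          have h3 : bumpKer =ᶠ[𝓝 y] fun _ => 0 := by
            filter_upwards [Metric.isClosed_closedBall.isOpen_compl.mem_nhds hy] with z hz
            exact bumpKer_of_one_lt (not_le.1 (by simpa using hz))
          simp [hD, h3.fderiv_eq]
        simp [hz]
  have h3 : ∫ y, ‖D k y‖ ≤ ∑ k, ∫ y, ‖D k y‖ :=
    Finset.single_le_sum (f := fun k => ∫ y, ‖D k y‖)
      (fun _ _ => integral_nonneg fun _ => norm_nonneg _) (Finset.mem_univ k)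
  have h4 : (∫ y : Para n, bumpKer y) * ‖Monogenic.pderiv k f 0‖ ≤ (∑ k, ∫ y, ‖D k y‖) * M := by
    have h5 := congrArg norm h1
    rw [norm_neg, norm_smul, Real.norm_of_nonneg hI.le] at h5
    rw [← h5]
    refine h2.trans ?_
    rw [integral_mul_const]
    gcongr
  rw [gradConst, mul_assoc, inv_mul_eq_div, le_div_iff₀' hI]
  exact h4

theorem IsEntireLeftMonogenic.norm_pderiv_le {n : ℕ} {f : Para n → Cl n}
    (hf : IsEntireLeftMonogenic f) {x : Para n} {r M : ℝ} (hr : 0 < r)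
    (hM : ∀ y ∈ Metric.closedBall x r, ‖f y‖ ≤ M) (k : Fin (n + 1)) :
    ‖Monogenic.pderiv k f x‖ ≤ gradConst n / r * M := by
  have h := (hf.comp_add_smul x r).norm_pderiv_zero_le (M := M) (fun y hy => hM _ ?_) k
  · rw [pderiv_comp_add_smul (hf.1.differentiable one_ne_zero), smul_zero, add_zero, norm_smul,
      Real.norm_of_nonneg hr.le] at h
    rw [div_mul_eq_mul_div, le_div_iff₀' hr]
    exact h
  · rw [mem_closedBall_iff_norm, add_sub_cancel_left, norm_smul, Real.norm_of_nonneg hr.le]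
    exact mul_le_of_le_one_right hr.le (by simpa using hy)

/-! ### Taylor series of entire monogenic functions -/

/-- The `k`-th derivative of `t ↦ f (x + t y)` at `t = 0`, that is `(∑ᵢ yᵢ ∂ᵢ)ᵏ f (x)` with `y`
held constant. -/
def homTaylor {n : ℕ} : ℕ → (Para n → Cl n) → Para n → Para n → Cl n
  | 0, f, x, _ => f x
  | k + 1, f, x, y => ∑ i, y i • homTaylor k (pderiv i f) x y

theorem IsEntireLeftMonogenic.contDiff_comp_smul {n : ℕ} {f : Para n → Cl n}
    (hf : IsEntireLeftMonogenic f) (y : Para n) {m : ℕ∞} :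
    ContDiff ℝ m fun t : ℝ => f (t • y) :=
  hf.contDiff.comp (contDiff_id.smul contDiff_const)

theorem IsEntireLeftMonogenic.iteratedDeriv_comp_smul {n : ℕ} (k : ℕ) {f : Para n → Cl n}
    (hf : IsEntireLeftMonogenic f) (y : Para n) (t : ℝ) :
    iteratedDeriv k (fun t : ℝ => f (t • y)) t = homTaylor k f (t • y) y := by
  induction k generalizing f with
  | zero => simp [homTaylor]
  | succ k ih =>
    have h1 : deriv (fun t : ℝ => f (t • y)) = fun t => ∑ i, y i • Monogenic.pderiv i f (t • y) := by
      funext s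
      have h2 : HasDerivAt (fun t : ℝ => t • y) y s := by
        simpa using (hasDerivAt_id s).smul_const y
      rw [← fderiv_apply_eq_sum_pderiv]
      exact ((hf.1.differentiable one_ne_zero _).hasFDerivAt.comp_hasDerivAt s h2).deriv
    have h3 (i) : ContDiff ℝ k fun t : ℝ => Monogenic.pderiv i f (t • y) :=
      (hf.pderiv i).contDiff_comp_smul y
    rw [iteratedDeriv_succ', h1, iteratedDeriv_fun_sum
      fun i _ => ((h3 i).const_smul (y i)).contDiffAt]
    simp only [homTaylor]
    refine Finset.sum_congr rfl fun i _ => ?_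
    rw [iteratedDeriv_fun_const_smul (h3 i).contDiffAt, ih (hf.pderiv i)]

theorem IsEntireLeftMonogenic.norm_pderiv_le_on {n : ℕ} {f : Para n → Cl n}
    (hf : IsEntireLeftMonogenic f) {x : Para n} {δ M : ℝ} (hδ : 0 < δ) (k : ℕ)
    (hM : ∀ z ∈ Metric.closedBall x ((k + 1 : ℕ) * δ), ‖f z‖ ≤ M) (i : Fin (n + 1)) :
    ∀ z ∈ Metric.closedBall x (k * δ), ‖Monogenic.pderiv i f z‖ ≤ gradConst n / δ * M := by
  intro z hz
  refine hf.norm_pderiv_le hδ (fun w hw => hM w ?_) i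
  rw [Metric.mem_closedBall] at hz hw ⊢
  push_cast
  linarith [dist_triangle w z x]

/-- Cauchy estimates, from `k` gradient estimates on balls of radius `δ`. -/
theorem IsEntireLeftMonogenic.norm_homTaylor_le {n : ℕ} (k : ℕ) {f : Para n → Cl n}
    (hf : IsEntireLeftMonogenic f) {x : Para n} (y : Para n) {δ M : ℝ} (hδ : 0 < δ)
    (hM : ∀ z ∈ Metric.closedBall x (k * δ), ‖f z‖ ≤ M) :
    ‖homTaylor k f x y‖ ≤ ((n + 1) * ‖y‖ * (gradConst n / δ)) ^ k * M := by
  induction k generalizing f M with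
  | zero => simpa [homTaylor] using hM x (by simp)
  | succ k ih =>
    have h1 (i) := ih (hf.pderiv i) (hf.norm_pderiv_le_on hδ k hM i)
    calc ‖homTaylor (k + 1) f x y‖ ≤ ∑ i, ‖y i • homTaylor k (Monogenic.pderiv i f) x y‖ :=
          norm_sum_le _ _
      _ ≤ ∑ _i : Fin (n + 1), ‖y‖ * (((n + 1) * ‖y‖ * (gradConst n / δ)) ^ k *
            (gradConst n / δ * M)) := by
          refine Finset.sum_le_sum fun i _ => ?_
          rw [norm_smul]
          exact mul_le_mul (PiLp.norm_apply_le y i) (h1 i) (norm_nonneg _) (norm_nonneg _)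
      _ = _ := by
          simp
          ring

/-- Converts the shape `(c (k+1) / r)ᵏ / k!` of Cauchy estimates over a ball of radius `r`
into a geometric rate. -/
theorem inv_factorial_mul_pow_le {q : ℝ} (hq : 0 ≤ q) (k : ℕ) :
    ((k.factorial : ℝ)⁻¹) * (q * (k + 1)) ^ k ≤ Real.exp 1 * (q * Real.exp 1) ^ k := by
  have h := Real.pow_div_factorial_le_exp (k + 1 : ℝ) (by positivity) k
  have h2 : Real.exp (k + 1 : ℝ) = Real.exp 1 ^ k * Real.exp 1 := by
    rw [Real.exp_add, ← Real.exp_nat_mul, mul_one]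
  calc ((k.factorial : ℝ)⁻¹) * (q * (k + 1)) ^ k = q ^ k * ((k + 1) ^ k / k.factorial) := by
        rw [mul_pow]; ring
    _ ≤ q ^ k * (Real.exp 1 ^ k * Real.exp 1) := by rw [← h2]; gcongr
    _ = _ := by rw [mul_pow]; ring

theorem exists_pos_div_mul_exp_le_half (A : ℝ) : ∃ r : ℝ, 0 < r ∧ A / r * Real.exp 1 ≤ 1 / 2 := by
  refine ⟨2 * (|A| + 1) * Real.exp 1, by positivity, ?_⟩
  have h : 0 < Real.exp 1 := Real.exp_pos 1
  rw [div_mul_eq_mul_div, div_le_iff₀ (by positivity)]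
  nlinarith [le_abs_self A]

theorem mul_div_succ_le {r : ℝ} (hr : 0 ≤ r) (k : ℕ) : k * (r / (k + 1)) ≤ r := by
  rw [mul_div_assoc', div_le_iff₀ (by positivity)]
  nlinarith

theorem IsEntireLeftMonogenic.hasSum_homTaylor {n : ℕ} {f : Para n → Cl n}
    (hf : IsEntireLeftMonogenic f) (y : Para n) :
    HasSum (fun k : ℕ => ((k.factorial : ℝ)⁻¹) • homTaylor k f 0 y) (f y) := by
  set A := (n + 1) * ‖y‖ * gradConst n with hA
  have hA0 : 0 ≤ A := mul_nonneg (by positivity) (gradConst_nonneg n)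
  obtain ⟨r, hr, hrA⟩ := exists_pos_div_mul_exp_le_half A
  have hq0 : 0 ≤ A / r * Real.exp 1 := by positivity
  obtain ⟨M, hM⟩ := (isCompact_closedBall (0 : Para n) (‖y‖ + r)).exists_bound_of_continuousOn
    hf.1.continuous.continuousOn
  have hM0 : 0 ≤ M := (norm_nonneg _).trans (hM 0 (by simp; positivity))
  have hbound (k : ℕ) (t : ℝ) (ht : t ∈ Set.Icc (0 : ℝ) 1) :
      ((k.factorial : ℝ)⁻¹) * ‖homTaylor k f (t • y) y‖ ≤ Real.exp 1 * (1 / 2) ^ k * M := by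
    -- The `k` balls of radius `r / (k + 1)` fit into one of radius `r`, also for `k = 0`.
    have h1 := hf.norm_homTaylor_le k (x := t • y) y (δ := r / (k + 1)) (M := M)
      (by positivity) (fun z hz => hM z ?_)
    · have h2 : (n + 1) * ‖y‖ * (gradConst n / (r / (k + 1))) = A / r * (k + 1) := by
        rw [hA]; field_simp
      rw [h2] at h1
      calc ((k.factorial : ℝ)⁻¹) * ‖homTaylor k f (t • y) y‖
          ≤ ((k.factorial : ℝ)⁻¹) * ((A / r * (k + 1)) ^ k * M) := by gcongr
        _ = ((k.factorial : ℝ)⁻¹) * (A / r * (k + 1)) ^ k * M := by ring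
        _ ≤ Real.exp 1 * (A / r * Real.exp 1) ^ k * M := by
            exact mul_le_mul_of_nonneg_right (inv_factorial_mul_pow_le (by positivity) k) hM0
        _ ≤ Real.exp 1 * (1 / 2) ^ k * M := by gcongr
    · have h3 : ‖t • y‖ ≤ ‖y‖ := by
        rw [norm_smul, Real.norm_of_nonneg ht.1]
        exact mul_le_of_le_one_left (norm_nonneg _) ht.2
      rw [mem_closedBall_iff_norm] at hz
      rw [mem_closedBall_zero_iff]
      have h4 := mul_div_succ_le hr.le k
      have h5 : ‖z‖ ≤ ‖z - t • y‖ + ‖t • y‖ := by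
        simpa using norm_add_le (z - t • y) (t • y)
      linarith
  have hsum : Summable fun k : ℕ => ((k.factorial : ℝ)⁻¹) • homTaylor k f 0 y := by
    refine Summable.of_norm_bounded (g := fun k => Real.exp 1 * (1 / 2) ^ k * M)
      ((summable_geometric_two.mul_left _).mul_right _) fun k => ?_
    rw [norm_smul, Real.norm_of_nonneg (by positivity)]
    simpa using hbound k 0 (by simp)
  have hsmooth {m : ℕ∞} : ContDiff ℝ m fun t : ℝ => f (t • y) := hf.contDiff_comp_smul y
  have hwithin (k : ℕ) (t : ℝ) (ht : t ∈ Set.Icc (0 : ℝ) 1) :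
      iteratedDerivWithin k (fun t : ℝ => f (t • y)) (Set.Icc 0 1) t =
        homTaylor k f (t • y) y := by
    rw [iteratedDerivWithin_eq_iteratedDeriv (uniqueDiffOn_Icc zero_lt_one)
      (hsmooth (m := k)).contDiffAt ht, hf.iteratedDeriv_comp_smul]
  have hrem (m : ℕ) :
      ‖f y - ∑ k ∈ Finset.range (m + 1), ((k.factorial : ℝ)⁻¹) • homTaylor k f 0 y‖ ≤
        Real.exp 1 * M * ((m + 1 : ℕ) * (1 / 2) ^ (m + 1)) := by
    have h := taylor_mean_remainder_bound (f := fun t : ℝ => f (t • y)) (n := m) (x := 1)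
      (C := (m + 1).factorial * (Real.exp 1 * (1 / 2) ^ (m + 1) * M))
      zero_le_one (hsmooth (m := (m + 1 : ℕ))).contDiffOn (by simp) (fun t ht => ?_)
    · rw [taylor_within_apply] at h
      have h2 : ∑ k ∈ Finset.range (m + 1), ((k.factorial : ℝ)⁻¹ * (1 - 0) ^ k) •
          iteratedDerivWithin k (fun t : ℝ => f (t • y)) (Set.Icc 0 1) 0 =
          ∑ k ∈ Finset.range (m + 1), ((k.factorial : ℝ)⁻¹) • homTaylor k f 0 y := by
        refine Finset.sum_congr rfl fun k _ => ?_
        rw [hwithin k 0 (by simp)]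
        simp
      rw [h2] at h
      simp only [one_smul, sub_zero, one_pow, mul_one] at h
      refine h.trans (le_of_eq ?_)
      have hf : (m.factorial : ℝ) ≠ 0 := by positivity
      rw [Nat.factorial_succ]
      push_cast
      field_simp
    · rw [hwithin _ t ht]
      have := hbound (m + 1) t ht
      rwa [inv_mul_le_iff₀ (by positivity)] at this
  have hlim : Tendsto (fun m : ℕ => Real.exp 1 * M * ((m + 1 : ℕ) * (1 / 2 : ℝ) ^ (m + 1)))
      atTop (𝓝 0) := by
    have h := (tendsto_self_mul_const_pow_of_lt_one (r := (1 / 2 : ℝ)) (by norm_num)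
      (by norm_num)).comp (tendsto_add_atTop_nat 1)
    simpa using h.const_mul (Real.exp 1 * M)
  have hpart : Tendsto (fun m : ℕ => ∑ k ∈ Finset.range (m + 1),
      ((k.factorial : ℝ)⁻¹) • homTaylor k f 0 y) atTop (𝓝 (f y)) := by
    rw [tendsto_iff_norm_sub_tendsto_zero]
    exact squeeze_zero (fun _ => norm_nonneg _)
      (fun m => by rw [norm_sub_rev]; exact hrem m) hlim
  have huniq := tendsto_nhds_unique hpart
    (hsum.hasSum.tendsto_sum_nat.comp (tendsto_add_atTop_nat 1))
  rw [huniq]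
  exact hsum.hasSum

/-! ### The monogenic exponential on a coordinate line -/

theorem fueterPoly_of_zero {n k : ℕ} (ℓ : Fin k → Fin n) {x : Para n} (hx : x 0 = 0) :
    fueterPoly ℓ x = algebraMap ℝ (Cl n) (∏ r, x (ℓ r).succ) := by
  have h (s : Equiv.Perm (Fin k)) : (List.ofFn fun r : Fin k => fueterVar (ℓ (s r)) x).prod =
      algebraMap ℝ (Cl n) (∏ r, x (ℓ r).succ) := by
    rw [← Equiv.prod_comp s, ← List.prod_ofFn, map_list_prod, List.map_ofFn]
    simp [fueterVar, hx, Function.comp_def]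
  simp only [fueterPoly, h, Finset.sum_const, Finset.card_univ, Fintype.card_perm,
    Fintype.card_fin]
  rw [← Nat.cast_smul_eq_nsmul ℝ, inv_smul_smul₀ (by positivity)]

theorem ckPow_smul_single {n : ℕ} (i : Fin n) (k : ℕ) (t : ℝ) :
    ckPow k (t • EuclideanSpace.single i.succ 1 : Para n) = t ^ k • (e i : Cl n) ^ k := by
  have hx : (t • EuclideanSpace.single i.succ 1 : Para n) 0 = 0 := by
    simp [(Fin.succ_ne_zero i).symm]
  rw [ckPow, Finset.sum_eq_single (fun _ => i)]
  · rw [fueterPoly_of_zero _ hx]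
    simp [List.ofFn_const, Algebra.smul_def]
  · intro ℓ _ hℓ
    obtain ⟨r, hr⟩ := Function.ne_iff.1 hℓ
    rw [fueterPoly_of_zero _ hx, Finset.prod_eq_zero (Finset.mem_univ r), map_zero, zero_mul]
    simp [hr]
  · simp

theorem e_pow_even {n : ℕ} (i : Fin n) (k : ℕ) : (e i : Cl n) ^ (2 * k) = (-1 : ℝ) ^ k • 1 := by
  rw [pow_mul, pow_two, e_mul_self]
  rcases Nat.even_or_odd k with h | h <;> simp [h.neg_one_pow]

theorem monExp_smul_single {n : ℕ} (i : Fin n) (t : ℝ) :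
    monExp (t • EuclideanSpace.single i.succ 1 : Para n) =
      Real.cos t • (1 : Cl n) + Real.sin t • e i := by
  refine HasSum.tsum_eq (HasSum.even_add_odd ?_ ?_)
  · convert! (Real.hasSum_cos t).smul_const (1 : Cl n) using 2 with k
    rw [ckPow_smul_single, e_pow_even, smul_smul, smul_smul]
    congr 1
    ring
  · convert! (Real.hasSum_sin t).smul_const (e i : Cl n) using 2 with k
    rw [ckPow_smul_single, pow_succ (e i : Cl n), e_pow_even, smul_mul_assoc, one_mul, smul_smul,
      smul_smul]
    congr 1
    ring

theorem iteratedDeriv_monExp_mul {n : ℕ} (i : Fin n) (k : ℕ) (s : ℝ) (X : Cl n) :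
    iteratedDeriv k (fun t : ℝ => monExp (s • t • EuclideanSpace.single i.succ 1 : Para n) * X) 0 =
      s ^ k • (e i ^ k * X) := by
  have h1 (X : Cl n) (t : ℝ) :
      HasDerivAt (fun t : ℝ => monExp (s • t • EuclideanSpace.single i.succ 1 : Para n) * X)
        (monExp (s • t • EuclideanSpace.single i.succ 1 : Para n) * (s • (e i * X))) t := by
    simp only [smul_smul, monExp_smul_single, add_mul, smul_mul_assoc, one_mul]
    have hs : HasDerivAt (fun t => s * t) s t := by simpa using (hasDerivAt_id t).const_mul s
    have h2 := (hs.cos.smul_const X).add (hs.sin.smul_const (e i * X))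
    refine h2.congr_deriv ?_
    rw [mul_smul_comm, ← mul_assoc, e_mul_self, neg_one_mul]
    module
  induction k generalizing X with
  | zero => simp only [iteratedDeriv_zero, smul_smul, mul_zero, monExp_smul_single]; simp
  | succ k ih =>
    rw [iteratedDeriv_succ', funext fun t => (h1 X t).deriv, ih, mul_smul_comm, smul_smul,
      ← mul_assoc, ← pow_succ, ← pow_succ]

/-! ### Power series with a majorant -/

/-- `p` is given on `ℝ` by a power series `∑ c_l t^l` with `∑ |c_l| B^l ≤ M`. -/
def HasMajorant (B M : ℝ) (p : ℝ → ℝ) : Prop :=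
  ∃ c : ℕ → ℝ, (∀ t : ℝ, HasSum (fun l : ℕ => c l * t ^ l) (p t)) ∧
    ∃ m ≤ M, HasSum (fun l : ℕ => |c l| * B ^ l) m

theorem summable_abs_coeff_mul_pow {c : ℕ → ℝ} {p : ℝ → ℝ}
    (hc : ∀ t : ℝ, HasSum (fun l : ℕ => c l * t ^ l) (p t)) {B : ℝ} (hB : 0 ≤ B) :
    Summable fun l : ℕ => |c l| * B ^ l := by
  refine (hc B).summable.abs.congr fun l => ?_
  rw [abs_mul, abs_of_nonneg (pow_nonneg hB l)]

theorem IsEntireReal.exists_hasMajorant {p : ℝ → ℝ} (hp : IsEntireReal p) {B : ℝ} (hB : 0 ≤ B) :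
    ∃ M, HasMajorant B M p := by
  obtain ⟨c, hc⟩ := hp
  exact ⟨_, c, hc, _, le_rfl, (summable_abs_coeff_mul_pow hc hB).hasSum⟩

theorem HasMajorant.mono {B M M' : ℝ} {p : ℝ → ℝ} (h : HasMajorant B M p) (hM : M ≤ M') :
    HasMajorant B M' p := by
  obtain ⟨c, hc, m, hm, hs⟩ := h
  exact ⟨c, hc, m, hm.trans hM, hs⟩

theorem HasMajorant.const_mul {B M : ℝ} {p : ℝ → ℝ} (h : HasMajorant B M p) {x X : ℝ}
    (hB : 0 ≤ B) (hx : |x| ≤ X) : HasMajorant B (X * M) fun t => x * p t := by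
  obtain ⟨c, hc, m, hm, hs⟩ := h
  have hm0 : 0 ≤ m := hs.nonneg fun l => by positivity
  refine ⟨fun l => x * c l, fun t => ?_, |x| * m, ?_, ?_⟩
  · simpa only [mul_assoc] using (hc t).mul_left x
  · exact mul_le_mul hx hm hm0 ((abs_nonneg x).trans hx)
  · simpa only [abs_mul, mul_assoc] using hs.mul_left |x|

theorem hasMajorant_one {B : ℝ} : HasMajorant B 1 fun _ => 1 := by
  refine ⟨fun l => if l = 0 then 1 else 0, fun t => ?_, 1, le_rfl, ?_⟩
  · convert! hasSum_ite_eq (0 : ℕ) (1 : ℝ) using 2 with l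
    split_ifs with h <;> simp [h]
  · convert! hasSum_ite_eq (0 : ℕ) (1 : ℝ) using 2 with l
    split_ifs with h <;> simp [h]

theorem HasMajorant.mul {B M M' : ℝ} {p p' : ℝ → ℝ} (hB : 0 ≤ B) (h : HasMajorant B M p)
    (h' : HasMajorant B M' p') : HasMajorant B (M * M') fun t => p t * p' t := by
  obtain ⟨c, hc, m, hm, hs⟩ := h
  obtain ⟨d, hd, m', hm', hs'⟩ := h'
  have hm0 : 0 ≤ m := hs.nonneg fun l => by positivity
  have hm0' : 0 ≤ m' := hs'.nonneg fun l => by positivity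
  have hcauchy {u v : ℕ → ℝ} {U V : ℝ} (hu : HasSum u U) (hv : HasSum v V) :
      HasSum (fun l => ∑ kl ∈ Finset.HasAntidiagonal.antidiagonal l, u kl.1 * v kl.2) (U * V) := by
    have h1 := tsum_mul_tsum_eq_tsum_sum_antidiagonal_of_summable_norm hu.summable.norm
      hv.summable.norm
    rw [hu.tsum_eq, hv.tsum_eq] at h1
    rw [h1]
    exact (summable_norm_sum_mul_antidiagonal_of_summable_norm hu.summable.norm
      hv.summable.norm).of_norm.hasSum
  have hpow (u v : ℕ → ℝ) (t : ℝ) (l : ℕ) :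
      ∑ kl ∈ Finset.HasAntidiagonal.antidiagonal l, (u kl.1 * t ^ kl.1) * (v kl.2 * t ^ kl.2) =
        (∑ kl ∈ Finset.HasAntidiagonal.antidiagonal l, u kl.1 * v kl.2) * t ^ l := by
    rw [Finset.sum_mul]
    refine Finset.sum_congr rfl fun kl hkl => ?_
    rw [← Finset.HasAntidiagonal.mem_antidiagonal.1 hkl, pow_add]
    ring
  have hcd := hcauchy hs hs'
  simp only [hpow (fun l => |c l|) (fun l => |d l|)] at hcd
  have hle (l : ℕ) : |∑ kl ∈ Finset.HasAntidiagonal.antidiagonal l, c kl.1 * d kl.2| * B ^ l ≤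
      (∑ kl ∈ Finset.HasAntidiagonal.antidiagonal l, |c kl.1| * |d kl.2|) * B ^ l := by
    refine mul_le_mul_of_nonneg_right ((Finset.abs_sum_le_sum_abs _ _).trans_eq ?_) (by positivity)
    simp only [abs_mul]
  have hsum : Summable fun l : ℕ =>
      |∑ kl ∈ Finset.HasAntidiagonal.antidiagonal l, c kl.1 * d kl.2| * B ^ l :=
    Summable.of_nonneg_of_le (fun l => by positivity) hle hcd.summable
  refine ⟨fun l => ∑ kl ∈ Finset.HasAntidiagonal.antidiagonal l, c kl.1 * d kl.2, fun t => ?_, _, ?_,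
    hsum.hasSum⟩
  · have h1 := hcauchy (hc t) (hd t)
    simpa only [hpow] using h1
  · calc _ ≤ m * m' := hasSum_le hle hsum.hasSum hcd
      _ ≤ M * M' := mul_le_mul hm hm' hm0' (hm0.trans hm)

/-! ### The superoscillation error functional -/

/-- The functional `φ ↦ ∑_{j ∈ s} Z_j φ(h_j) - φ(a)`. -/
def errL {n : ℕ} (s : Finset ℕ) (h : ℕ → ℝ) (Z : ℕ → Cl n) (a : ℝ) :
    (ℝ → Cl n) →ₗ[ℝ] Cl n where
  toFun φ := ∑ j ∈ s, Z j * φ (h j) - φ a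
  map_add' φ φ' := by
    simp only [Pi.add_apply, mul_add, Finset.sum_add_distrib]
    abel
  map_smul' r φ := by
    simp only [Pi.smul_apply, mul_smul_comm, ← Finset.smul_sum, smul_sub, RingHom.id_apply]

section errL

variable {n : ℕ} {s : Finset ℕ} {h : ℕ → ℝ} {Z : ℕ → Cl n} {a : ℝ}

theorem errL_apply (φ : ℝ → Cl n) : errL s h Z a φ = ∑ j ∈ s, Z j * φ (h j) - φ a := rfl

theorem hasSum_errL {F : ℕ → ℝ → Cl n} {φ : ℝ → Cl n} (hF : ∀ t, HasSum (fun k => F k t) (φ t)) :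
    HasSum (fun k => errL s h Z a (F k)) (errL s h Z a φ) := by
  simp only [errL_apply]
  refine HasSum.sub (hasSum_sum fun j _ => ?_) (hF a)
  exact (mulL n (Z j)).hasSum (hF (h j))

theorem errL_smul_const (p : ℝ → ℝ) (v : Cl n) :
    errL s h Z a (fun t => p t • v) = errL s h Z a (fun t => p t • 1) * v := by
  simp [errL_apply, sub_mul, Finset.sum_mul]

theorem norm_errL_smul_const_le {ε B M : ℝ} (hε : 0 ≤ ε)
    (hmom : ∀ l : ℕ, ‖errL s h Z a fun t => t ^ l • 1‖ ≤ ε * B ^ l) {p : ℝ → ℝ}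
    (hp : HasMajorant B M p) (v : Cl n) :
    ‖errL s h Z a fun t => p t • v‖ ≤ ‖mulL n‖ * (ε * M) * ‖v‖ := by
  obtain ⟨c, hc, m, hm, hs⟩ := hp
  rw [errL_smul_const]
  refine (norm_mul_le_mulL _ _).trans ?_
  gcongr
  have h1 : HasSum (fun l : ℕ => errL s h Z a (c l • fun t => t ^ l • 1))
      (errL s h Z a fun t => p t • 1) := by
    refine hasSum_errL fun t => ?_
    simpa only [Pi.smul_apply, smul_smul] using (hc t).smul_const (1 : Cl n)
  refine (h1.norm_le_of_bounded (hs.mul_left ε) fun l => ?_).trans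
    (mul_le_mul_of_nonneg_left hm hε)
  rw [map_smul, norm_smul, Real.norm_eq_abs, mul_left_comm]
  exact mul_le_mul_of_nonneg_left (hmom l) (abs_nonneg _)

/-- Cauchy estimates for the error functional applied to the `k`-th Taylor polynomial of `f` at
the points `(x_i g_i(t))_i`; the scalar weight `p` carries the factors already split off in the
induction. -/
theorem norm_errL_homTaylor_le {ε B A X : ℝ} (hε : 0 ≤ ε) (hB : 0 ≤ B)
    (hmom : ∀ l : ℕ, ‖errL s h Z a fun t => t ^ l • 1‖ ≤ ε * B ^ l)
    {g : Fin (n + 1) → ℝ → ℝ} (hg : ∀ i, HasMajorant B A (g i)) {x : Para n} (hx : ‖x‖ ≤ X)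
    (k : ℕ) {f : Para n → Cl n} (hf : IsEntireLeftMonogenic f) {δ m M : ℝ} (hδ : 0 < δ)
    (hm : ∀ z ∈ Metric.closedBall 0 (k * δ), ‖f z‖ ≤ m) {p : ℝ → ℝ} (hM : 0 ≤ M)
    (hp : HasMajorant B M p) :
    ‖errL s h Z a fun t => p t • homTaylor k f 0 (WithLp.toLp 2 fun i => x i * g i t)‖ ≤
      ‖mulL n‖ * (ε * M) * (((n + 1) * (X * A) * (gradConst n / δ)) ^ k * m) := by
  have hA : 0 ≤ A := by
    obtain ⟨c, -, m, hm, hs⟩ := hg 0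
    exact (hs.nonneg fun l => by positivity).trans hm
  have hX : 0 ≤ X := (norm_nonneg x).trans hx
  induction k generalizing f m M p with
  | zero =>
    refine (norm_errL_smul_const_le hε hmom hp (f 0)).trans ?_
    have h1 := hm 0 (by simp)
    simp only [pow_zero, one_mul]
    gcongr
  | succ k ih =>
    have h1 : (fun t => p t • homTaylor (k + 1) f 0 (WithLp.toLp 2 fun i => x i * g i t)) =
        ∑ i, fun t => (p t * (x i * g i t)) •
          homTaylor k (pderiv i f) 0 (WithLp.toLp 2 fun i => x i * g i t) := by
      funext t
      simp only [homTaylor, Finset.smul_sum, smul_smul, Finset.sum_apply]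
    rw [h1, map_sum]
    refine (norm_sum_le_of_le _ fun i _ => ih (hf.pderiv i) (hf.norm_pderiv_le_on hδ k hm i)
      (M := M * (X * A)) (by positivity) (hp.mul hB ((hg i).const_mul hB
        ((PiLp.norm_apply_le x i).trans hx)))).trans (le_of_eq ?_)
    simp
    ring

/-- If the moments of the error functional are at most `ε Bˡ`, then its value at
`t ↦ f ((x_i g_i(t))_i)` is `O(ε)`, uniformly for bounded `x`. The radius of the ball in the
Cauchy estimates for `f` is chosen so large that they sum to a geometric series. -/
theorem exists_norm_errL_comp_le {B X : ℝ} (hB : 0 ≤ B) {g : Fin (n + 1) → ℝ → ℝ}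
    (hg : ∀ i, IsEntireReal (g i)) {f : Para n → Cl n} (hf : IsEntireLeftMonogenic f) :
    ∃ L : ℝ, ∀ (s : Finset ℕ) (h : ℕ → ℝ) (Z : ℕ → Cl n) (a ε : ℝ), 0 ≤ ε →
      (∀ l : ℕ, ‖errL s h Z a fun t => t ^ l • 1‖ ≤ ε * B ^ l) → ∀ x : Para n, ‖x‖ ≤ X →
      ‖errL s h Z a fun t => f (WithLp.toLp 2 fun i => x i * g i t)‖ ≤ L * ε := by
  choose A' hA' using fun i => (hg i).exists_hasMajorant hB
  set A := ∑ i, |A' i| with hA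
  have hA0 : 0 ≤ A := Finset.sum_nonneg fun _ _ => abs_nonneg _
  have hgA (i) : HasMajorant B A (g i) := (hA' i).mono ((le_abs_self _).trans
    (Finset.single_le_sum (f := fun i => |A' i|) (fun _ _ => abs_nonneg _) (Finset.mem_univ i)))
  obtain ⟨r, hr, hrA⟩ := exists_pos_div_mul_exp_le_half ((n + 1) * (X * A) * gradConst n)
  obtain ⟨m, hm⟩ := (isCompact_closedBall (0 : Para n) r).exists_bound_of_continuousOn
    hf.1.continuous.continuousOn
  have hm0 : 0 ≤ m := (norm_nonneg _).trans (hm 0 (by simp [hr.le]))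
  refine ⟨‖mulL n‖ * Real.exp 1 * m * 2, fun s h Z a ε hε hmom x hx => ?_⟩
  have hX : 0 ≤ X := (norm_nonneg x).trans hx
  have hG := gradConst_nonneg n
  set q := (n + 1) * (X * A) * gradConst n / r with hq
  have hq0 : 0 ≤ q := by positivity
  have hsum : HasSum (fun k : ℕ => errL s h Z a (((k.factorial : ℝ)⁻¹) • fun t =>
      (1 : ℝ) • homTaylor k f 0 (WithLp.toLp 2 fun i => x i * g i t)))
      (errL s h Z a fun t => f (WithLp.toLp 2 fun i => x i * g i t)) :=
    hasSum_errL fun t => by simpa only [Pi.smul_apply, one_smul] using hf.hasSum_homTaylor _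
  refine (hsum.norm_le_of_bounded
    (hasSum_geometric_two.mul_left (‖mulL n‖ * ε * Real.exp 1 * m)) fun k => ?_).trans_eq (by ring)
  have h1 := norm_errL_homTaylor_le hε hB hmom hgA hx k hf (δ := r / (k + 1)) (m := m)
    (by positivity) (fun z hz => hm z (Metric.closedBall_subset_closedBall
      (mul_div_succ_le hr.le k) hz)) zero_le_one hasMajorant_one
  have h2 : (n + 1) * (X * A) * (gradConst n / (r / (k + 1))) = q * (k + 1) := by
    rw [hq]; field_simp
  rw [h2] at h1
  rw [map_smul, norm_smul, Real.norm_of_nonneg (by positivity)]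
  calc _ ≤ ((k.factorial : ℝ)⁻¹) * (‖mulL n‖ * (ε * 1) * ((q * (k + 1)) ^ k * m)) := by gcongr
    _ = ‖mulL n‖ * ε * m * (((k.factorial : ℝ)⁻¹) * (q * (k + 1)) ^ k) := by ring
    _ ≤ ‖mulL n‖ * ε * m * (Real.exp 1 * (q * Real.exp 1) ^ k) :=
        mul_le_mul_of_nonneg_left (inv_factorial_mul_pow_le hq0 k) (by positivity)
    _ ≤ ‖mulL n‖ * ε * m * (Real.exp 1 * (1 / 2) ^ k) := by gcongr
    _ = _ := by ring

end errL

/-! ### Moments of a superoscillating sequence -/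

/-- Left multiplication by `e_i` is bounded below, since `-e_i` is its inverse. -/
theorem norm_le_mul_norm_e_pow_mul {n : ℕ} (i : Fin n) (k : ℕ) (w : Cl n) :
    ‖w‖ ≤ (‖mulL n‖ * ‖(e i : Cl n)‖) ^ k * ‖e i ^ k * w‖ := by
  induction k generalizing w with
  | zero => simp
  | succ k ih =>
    have h1 : w = -(e i * (e i * w)) := by rw [← mul_assoc, e_mul_self]; simp
    calc ‖w‖ = ‖e i * (e i * w)‖ := by conv_lhs => rw [h1, norm_neg]
      _ ≤ ‖mulL n‖ * ‖(e i : Cl n)‖ * ‖e i * w‖ := norm_mul_le_mulL _ _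
      _ ≤ ‖mulL n‖ * ‖(e i : Cl n)‖ * ((‖mulL n‖ * ‖(e i : Cl n)‖) ^ k * ‖e i ^ k * (e i * w)‖) := by
          gcongr; exact ih _
      _ = _ := by rw [← mul_assoc (e i ^ k), ← pow_succ]; ring

/-- Growth of exponential type of `D(x) = ∑ E(h_j x) Z_j - E(a x)` bounds the moments
`∑ h_jˡ Z_j - aˡ`: up to the factor `e_iˡ` they are the Taylor coefficients of `D` along the
`x_i`-axis, on which the monogenic exponential is `cos t + e_i sin t`. -/
theorem norm_errL_pow_le {n : ℕ} (i : Fin n) {s : Finset ℕ} {h : ℕ → ℝ} {Z : ℕ → Cl n}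
    {a σ ε : ℝ} (hσ : 0 ≤ σ)
    (hD : IsEntireLeftMonogenic fun x : Para n =>
      ∑ j ∈ s, monExp (h j • x) * Z j - monExp (a • x)) (hε : 0 ≤ ε)
    (hbd : ∀ x : Para n, ‖∑ j ∈ s, monExp (h j • x) * Z j - monExp (a • x)‖ ≤
      ε * Real.exp (σ * ‖x‖)) (l : ℕ) :
    ‖errL s h Z a fun t => t ^ l • 1‖ ≤
      ε * (‖mulL n‖ * ‖(e i : Cl n)‖ * ((n + 1) * gradConst n * Real.exp σ)) ^ l := by
  set y : Para n := EuclideanSpace.single i.succ 1 with hy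
  have hT := hD.iteratedDeriv_comp_smul l y 0
  have hC (r : ℝ) (X : Cl n) : ContDiff ℝ l fun t : ℝ => monExp (r • t • y) * X := by
    simp only [smul_smul, hy, monExp_smul_single, add_mul, smul_mul_assoc]
    fun_prop
  have hder : iteratedDeriv l (fun t : ℝ =>
      ∑ j ∈ s, monExp (h j • t • y) * Z j - monExp (a • t • y)) 0 =
      e i ^ l * errL s h Z a fun t => t ^ l • 1 := by
    have h1 : ContDiff ℝ l fun t : ℝ => monExp (a • t • y) := by simpa using hC a 1
    have h2 : iteratedDeriv l (fun t : ℝ => monExp (a • t • y)) 0 = a ^ l • e i ^ l := by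
      simpa using iteratedDeriv_monExp_mul i l a 1
    rw [iteratedDeriv_fun_sub (ContDiff.sum fun j _ => hC (h j) (Z j)).contDiffAt
      h1.contDiffAt, h2,
      iteratedDeriv_fun_sum fun j _ => (hC (h j) (Z j)).contDiffAt]
    simp only [hy, iteratedDeriv_monExp_mul, errL_apply, mul_sub, Finset.mul_sum, mul_smul_comm,
      mul_one]
  -- Radius `l`: the growth factor `e^{σ l}` is geometric and the Cauchy factor `(l / r)ˡ` is one.
  have hnorm := hD.norm_homTaylor_le l (x := 0) y (δ := 1) (M := ε * Real.exp (σ * l)) one_pos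
    (fun z hz => (hbd z).trans ?_)
  · rw [zero_smul, hder] at hT
    rw [← hT] at hnorm
    have hy1 : ‖y‖ = 1 := by simp [hy]
    calc _ ≤ (‖mulL n‖ * ‖(e i : Cl n)‖) ^ l * ‖e i ^ l * errL s h Z a fun t => t ^ l • 1‖ :=
          norm_le_mul_norm_e_pow_mul i l _
      _ ≤ (‖mulL n‖ * ‖(e i : Cl n)‖) ^ l *
          (((n + 1) * ‖y‖ * (gradConst n / 1)) ^ l * (ε * Real.exp (σ * l))) := by gcongr
      _ = _ := by
          rw [hy1, mul_comm σ, Real.exp_nat_mul]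
          simp only [mul_pow, mul_one, div_one]
          ring
  · have hz' : ‖z‖ ≤ l := by simpa using hz
    gcongr

theorem MemA1.bddAbove_sub {n : ℕ} {σ : ℝ} {f f' : Para n → Cl n} (hf : MemA1 σ f)
    (hf' : MemA1 σ f') :
    BddAbove (Set.range fun x : Para n => ‖f x - f' x‖ * Real.exp (-σ * ‖x‖)) := by
  obtain ⟨b, hb⟩ := hf.2
  obtain ⟨b', hb'⟩ := hf'.2
  refine ⟨b + b', ?_⟩
  rintro _ ⟨x, rfl⟩
  calc ‖f x - f' x‖ * Real.exp (-σ * ‖x‖) ≤ (‖f x‖ + ‖f' x‖) * Real.exp (-σ * ‖x‖) := by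
        gcongr; exact norm_sub_le _ _
    _ = ‖f x‖ * Real.exp (-σ * ‖x‖) + ‖f' x‖ * Real.exp (-σ * ‖x‖) := add_mul _ _ _
    _ ≤ b + b' := add_le_add (hb ⟨x, rfl⟩) (hb' ⟨x, rfl⟩)

theorem norm_le_normA1_mul_exp {n : ℕ} {σ : ℝ} {f : Para n → Cl n}
    (hf : BddAbove (Set.range fun x : Para n => ‖f x‖ * Real.exp (-σ * ‖x‖))) (x : Para n) :
    ‖f x‖ ≤ normA1 σ f * Real.exp (σ * ‖x‖) := by
  have h := le_ciSup hf x
  calc ‖f x‖ = ‖f x‖ * Real.exp (-σ * ‖x‖) * Real.exp (σ * ‖x‖) := by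
        rw [mul_assoc, ← Real.exp_add]; simp
    _ ≤ _ := by gcongr; exact h

end Monogenic

end

theorem mainTheorem2 (n : ℕ) (hn : 1 ≤ n) (a : ℝ) (ha : 1 < |a|)
    (h : ℕ → ℕ → ℝ) (Z : ℕ → ℕ → Monogenic.Cl n)
    (hconv : Monogenic.ConvergesInA1
      (fun N x => ∑ j ∈ Finset.range (N + 1), Monogenic.monExp (h N j • x) * Z N j)
      (fun x => Monogenic.monExp (a • x)))
    (G : Monogenic.Para n → Monogenic.Cl n) (hG : Monogenic.IsEntireLeftMonogenic G)
    (g : Fin (n + 1) → ℝ → ℝ) (hg : ∀ k, Monogenic.IsEntireReal (g k)) :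
    ∀ K : Set (Monogenic.Para n), IsCompact K →
      TendstoUniformlyOn
        (fun (N : ℕ) (x : Monogenic.Para n) => ∑ j ∈ Finset.range (N + 1),
          Z N j * G (WithLp.toLp 2 fun k => x k * g k (h N j)))
        (fun x => G (WithLp.toLp 2 fun k => x k * g k a)) atTop K := by
  intro K hK
  obtain ⟨σ, hσ, hf, hF, hlim⟩ := hconv
  obtain ⟨X, hX⟩ := hK.isBounded.exists_norm_le
  have hC := Monogenic.gradConst_nonneg n
  obtain ⟨L, hL⟩ := Monogenic.exists_norm_errL_comp_le (X := X)
    (B := ‖Monogenic.mulL n‖ * ‖(Monogenic.e ⟨0, hn⟩ : Monogenic.Cl n)‖ *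
      ((n + 1) * Monogenic.gradConst n * Real.exp σ)) (by positivity) hg hG
  refine Metric.tendstoUniformlyOn_iff.2 fun η hη => ?_
  have hlim' := hlim.const_mul L
  rw [mul_zero] at hlim'
  filter_upwards [hlim'.eventually_lt_const hη] with N hN x hx
  rw [dist_comm, dist_eq_norm]
  refine lt_of_le_of_lt (hL (Finset.range (N + 1)) (h N) (Z N) a _ ?_ (fun l => ?_) x
    (hX x hx)) hN
  · exact Real.iSup_nonneg fun x => by positivity
  · exact Monogenic.norm_errL_pow_le _ hσ.le ((hF N).1.sub hf.1)
      (Real.iSup_nonneg fun x => by positivity)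
      (Monogenic.norm_le_normA1_mul_exp ((hF N).bddAbove_sub hf)) l
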